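/- Let $k$ be a field, let $n\ge 1$, and let $\Delta_n$ be the quiver with vertices $a\in\mathbb Z/n$ and one arrow $a\to a+1$ for each $a$. Let $A$ be a Nakayama algebra of order $n$ over $k$, that is, a finite-dimensional $k$-algebra isomorphic to the quotient of the path algebra $k\Delta_n$ by the two-sided ideal generated by a finite set of paths of length $\ge 1$. Paths are multiplied by concatenation from left to right, modules are finite-dimensional right modules, and for a vertex $a$ we write $e_a$ for its idempotent, $P_a=e_aA$, $S_a=P_a/\operatorname{rad}P_a$, and $I_a=\operatorname{Hom}_k(Ae_a,k)$. Let $\psi(a)=a-\dim_k I_a\in\mathbb Z/n$; the coresolution quiver $R^*_A$ has vertex set $\mathbb Z/n$ and exactly one arrow $a\to\psi(a)$ for each $a$. Let $a$ be a vertex and let $r\ge 0$. Suppose that a minimal projective resolution of $S_a$ is periodic after step $2r$, that is, its syzygies satisfy $\Omega^{2r}(S_a)\neq 0$ and $\Omega^{2r+s}(S_a)\cong\Omega^{2r}(S_a)$ for some $s\ge 1$. Then $$\sum_{0\le i\le p-1}\dim_k\Omega^{2r+2i}(S_a)=n'_a,$$ where $p$ is the number of vertices of any cycle of $R^*_A$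 (all cycles have the same number of vertices), and $n'_a$ is the number of vertices of the connected component of $R^*_A$ that contains $a$. -/

import Mathlib

universe u v

noncomputable section

namespace Nakayama

/-- A path in the cyclic quiver `Δ_n`, whose vertices are the elements of `ZMod n` and which has
exactly one arrow `a ⟶ a + 1` for every vertex `a`. Such a path is determined by its starting
vertex and its length. -/
@[ext]
structure CyclePath (n : ℕ) where
  source : ZMod n
  length : ℕ

/-- The vertex at which a path ends. -/
def CyclePath.target {n : ℕ} (p : CyclePath n) : ZMod n := p.source + (p.length : ZMod n)

open Classical in
/-- The product of two paths in the path algebra: their concatenation (first `p`, then `q`) if `p`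
ends where `q` starts, and `0` otherwise. -/
def pathMul (k : Type u) [Field k] {n : ℕ} (p q : CyclePath n) : CyclePath n →₀ k :=
  if p.target = q.source then Finsupp.single ⟨p.source, p.length + q.length⟩ 1 else 0

/-- The bilinear extension of the product of paths. -/
def pathMulHom (k : Type u) [Field k] (n : ℕ) :
    (CyclePath n →₀ k) →ₗ[k] (CyclePath n →₀ k) →ₗ[k] (CyclePath n →₀ k) :=
  Finsupp.lift _ k _ fun p => Finsupp.lift _ k _ fun q => pathMul k p q

/-- The path algebra `kΔ_n`: the `k`-vector space with basis the paths in `Δ_n`. -/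
def PathAlgebra (k : Type u) [Field k] (n : ℕ) : Type u := CyclePath n →₀ k

namespace PathAlgebra

variable (k : Type u) [Field k] (n : ℕ)

instance : AddCommGroup (PathAlgebra k n) := inferInstanceAs (AddCommGroup (CyclePath n →₀ k))

instance : Module k (PathAlgebra k n) := inferInstanceAs (Module k (CyclePath n →₀ k))

variable {n}

/-- A path as an element of the path algebra. -/
def ofPath (p : CyclePath n) : PathAlgebra k n := Finsupp.single p (1 : k)

variable (n)

/-- The multiplication of the path algebra as a bilinear map. -/
def mulHom : PathAlgebra k n →ₗ[k] PathAlgebra k n →ₗ[k] PathAlgebra k n := pathMulHom k n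

variable {k n} in
theorem hom_ext {M : Type*} [AddCommGroup M] [Module k M] {f g : PathAlgebra k n →ₗ[k] M}
    (h : ∀ p, f (ofPath k p) = g (ofPath k p)) : f = g :=
  Finsupp.lhom_ext' (M := k) (R := k) (φ := f) (ψ := g)
    fun p => LinearMap.ext_ring (h p)

instance : Mul (PathAlgebra k n) := ⟨fun x y => mulHom k n x y⟩

/-- The identity is the sum of the trivial paths. -/
instance [NeZero n] : One (PathAlgebra k n) := ⟨∑ a : ZMod n, ofPath k ⟨a, 0⟩⟩

theorem mul_def (x y : PathAlgebra k n) : x * y = mulHom k n x y := rfl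

theorem one_def [NeZero n] : (1 : PathAlgebra k n) = ∑ a : ZMod n, ofPath k ⟨a, 0⟩ := rfl

open Classical in
theorem mulHom_ofPath (p q : CyclePath n) :
    mulHom k n (ofPath k p) (ofPath k q) =
      if p.target = q.source then ofPath k ⟨p.source, p.length + q.length⟩ else 0 := by
  have h : pathMulHom k n (Finsupp.single p 1) (Finsupp.single q 1) = pathMul k p q := by
    simp [pathMulHom]
  exact h

theorem one_mul_aux [NeZero n] : mulHom k n (1 : PathAlgebra k n) = LinearMap.id := by
  classical
  refine hom_ext fun p => ?_
  rw [one_def, map_sum, LinearMap.sum_apply]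
  simp only [mulHom_ofPath, CyclePath.target, Nat.cast_zero, add_zero, zero_add]
  rw [Finset.sum_ite_eq']
  simp

theorem mul_one_aux [NeZero n] :
    (mulHom k n).flip (1 : PathAlgebra k n) = LinearMap.id := by
  classical
  refine hom_ext fun p => ?_
  rw [one_def, map_sum, LinearMap.sum_apply]
  simp only [LinearMap.flip_apply, mulHom_ofPath, add_zero]
  rw [Finset.sum_ite_eq]
  simp

theorem mul_assoc_ofPath (p q r : CyclePath n) :
    mulHom k n (mulHom k n (ofPath k p) (ofPath k q)) (ofPath k r) =
      mulHom k n (ofPath k p) (mulHom k n (ofPath k q) (ofPath k r)) := by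
  classical
  rw [mulHom_ofPath, mulHom_ofPath]
  by_cases h1 : p.target = q.source <;> by_cases h2 : q.target = r.source
  · have h3 : (⟨p.source, p.length + q.length⟩ : CyclePath n).target = r.source := by
      rw [← h2]; simp only [CyclePath.target] at h1 ⊢; rw [← h1]; push_cast; ring
    simp only [if_pos h1, if_pos h2, mulHom_ofPath, if_pos h3, add_assoc]
  · have h3 : ¬ (⟨p.source, p.length + q.length⟩ : CyclePath n).target = r.source := by
      intro h; apply h2; rw [← h]; simp only [CyclePath.target] at h1 ⊢; rw [← h1]; push_cast; ring
    simp only [if_pos h1, if_neg h2, mulHom_ofPath, if_neg h3, map_zero]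
  · simp only [if_neg h1, if_pos h2, mulHom_ofPath, map_zero, LinearMap.zero_apply]
  · simp only [if_neg h1, if_neg h2, map_zero, LinearMap.zero_apply]

theorem mul_assoc_aux (x y z : PathAlgebra k n) :
    mulHom k n (mulHom k n x y) z = mulHom k n x (mulHom k n y z) := by
  have step1 : ∀ p q : CyclePath n,
      mulHom k n (mulHom k n (ofPath k p) (ofPath k q)) =
        (mulHom k n (ofPath k p)) ∘ₗ (mulHom k n (ofPath k q)) := fun p q =>
    hom_ext fun r => mul_assoc_ofPath k n p q r
  have step2 : ∀ p : CyclePath n,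
      ((mulHom k n).flip z) ∘ₗ (mulHom k n (ofPath k p)) =
        (mulHom k n (ofPath k p)) ∘ₗ ((mulHom k n).flip z) := fun p =>
    hom_ext fun q => LinearMap.congr_fun (step1 p q) z
  have step3 : ((mulHom k n).flip z) ∘ₗ ((mulHom k n).flip y) =
      (mulHom k n).flip (mulHom k n y z) :=
    hom_ext fun p => LinearMap.congr_fun (step2 p) y
  exact LinearMap.congr_fun step3 x

instance [NeZero n] : Ring (PathAlgebra k n) :=
  { (inferInstance : AddCommGroup (PathAlgebra k n)),
    (inferInstance : Mul (PathAlgebra k n)),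
    (inferInstance : One (PathAlgebra k n)) with
    left_distrib := fun x y z => map_add (mulHom k n x) y z
    right_distrib := fun x y z => LinearMap.map_add₂ (mulHom k n) x y z
    zero_mul := fun x => LinearMap.map_zero₂ (mulHom k n) x
    mul_zero := fun x => map_zero (mulHom k n x)
    mul_assoc := mul_assoc_aux k n
    one_mul := fun x => LinearMap.congr_fun (one_mul_aux k n) x
    mul_one := fun x => LinearMap.congr_fun (mul_one_aux k n) x }

instance [NeZero n] : Algebra k (PathAlgebra k n) :=
  Algebra.ofModule (fun r x y => LinearMap.map_smul₂ (mulHom k n) r x y)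
    (fun r x y => map_smul (mulHom k n x) r y)

end PathAlgebra

/-- The two-sided ideal of `kΔ_n` generated by a finite set `R` of paths. -/
def relationIdeal (k : Type u) [Field k] {n : ℕ} [NeZero n] (R : Finset (CyclePath n)) :
    TwoSidedIdeal (PathAlgebra k n) :=
  TwoSidedIdeal.span (PathAlgebra.ofPath k '' (R : Set (CyclePath n)))

/-- The bound quiver algebra `kΔ_n / (R)`. -/
abbrev BoundQuiverAlgebra (k : Type u) [Field k] {n : ℕ} [NeZero n]
    (R : Finset (CyclePath n)) : Type u :=
  (relationIdeal k R).ringCon.Quotient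

/-- A presentation of a `k`-algebra `A` as a Nakayama algebra of order `n`: an isomorphism of
`A` with the quotient of `kΔ_n` by the ideal generated by a finite set of nontrivial paths. -/
structure Presentation (k : Type u) [Field k] (A : Type v) [Ring A] [Algebra k A]
    (n : ℕ) [NeZero n] where
  relations : Finset (CyclePath n)
  nontrivial : ∀ p ∈ relations, 1 ≤ p.length
  iso : A ≃ₐ[k] BoundQuiverAlgebra k relations

/-- The dimension over `k` of a right module over a `k`-algebra `A`. -/
def dim (k : Type u) [Field k] (A : Type v) [Ring A] [Algebra k A]
    (M : ModuleCat.{v} Aᵐᵒᵖ) : ℕ :=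
  Module.finrank k (RestrictScalars k Aᵐᵒᵖ M)

/-- A submodule `N` of `M` is superfluous if `N + L = M` implies `L = M`. -/
def IsSuperfluous {B : Type v} [Ring B] {M : Type v} [AddCommGroup M] [Module B M]
    (N : Submodule B M) : Prop :=
  ∀ L : Submodule B M, N ⊔ L = ⊤ → L = ⊤

/-- A minimal projective resolution `⋯ ⟶ X 2 ⟶ X 1 ⟶ X 0 ⟶ M ⟶ 0` by finitely generated
projective modules: each term is a projective cover of the corresponding syzygy. -/
structure MinimalProjectiveResolution {B : Type v} [Ring B] (M : ModuleCat.{v} B) where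
  X : ℕ → ModuleCat.{v} B
  finite : ∀ i, Module.Finite B (X i)
  projective : ∀ i, Module.Projective B (X i)
  ε : X 0 →ₗ[B] M
  d : ∀ i, X (i + 1) →ₗ[B] X i
  ε_surjective : Function.Surjective ε
  exact_zero : Function.Exact (d 0) ε
  exact_succ : ∀ i, Function.Exact (d (i + 1)) (d i)
  minimal_zero : IsSuperfluous (LinearMap.ker ε)
  minimal_succ : ∀ i, IsSuperfluous (LinearMap.ker (d i))

namespace MinimalProjectiveResolution

variable {B : Type v} [Ring B] {M : ModuleCat.{v} B}

/-- The syzygies `Ω^m(M)` computed from a minimal projective resolution of `M`. -/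
def syzygy (P : MinimalProjectiveResolution M) : ℕ → ModuleCat.{v} B
  | 0 => M
  | 1 => ModuleCat.of B (LinearMap.ker P.ε)
  | i + 2 => ModuleCat.of B (LinearMap.ker (P.d i))

/-- A minimal projective resolution is periodic after step `m` if, from step `m` on, it does not
stop and it repeats itself: `Ω^m(M)` is nonzero and isomorphic to `Ω^(m+s)(M)` for some
`s ≥ 1`. -/
def IsPeriodicAfter (P : MinimalProjectiveResolution M) (m : ℕ) : Prop :=
  Nontrivial (P.syzygy m) ∧ ∃ s : ℕ, 1 ≤ s ∧ Nonempty (P.syzygy (m + s) ≃ₗ[B] P.syzygy m)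

end MinimalProjectiveResolution

namespace Presentation

variable {k : Type u} [Field k] {A : Type v} [Ring A] [Algebra k A] {n : ℕ} [NeZero n]
  (N : Presentation k A n)

/-- The idempotent `e_a` of `A`. -/
def e (a : ZMod n) : A :=
  N.iso.symm ((PathAlgebra.ofPath k ⟨a, 0⟩ : PathAlgebra k n) :
    (relationIdeal k N.relations).ringCon.Quotient)

/-- The right projective module `P_a = e_a A`, as a right ideal of `A`. -/
def projectiveModule (a : ZMod n) : Submodule Aᵐᵒᵖ A := Submodule.span Aᵐᵒᵖ {N.e a}

/-- The simple right module `S_a = P_a / rad P_a`. -/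
def simpleModule (a : ZMod n) : ModuleCat.{v} Aᵐᵒᵖ :=
  ModuleCat.of Aᵐᵒᵖ (N.projectiveModule a ⧸ Module.jacobson Aᵐᵒᵖ (N.projectiveModule a))

/-- The (underlying vector space of the) injective right module `I_a = Hom_k(A e_a, k)`,
the `k`-dual of the left ideal `A e_a`. -/
abbrev InjectiveModule (a : ZMod n) : Type (max u v) :=
  Module.Dual k (Submodule.span A {N.e a} : Submodule A A)

/-- The dimension `q_a` of `I_a`. -/
def q (a : ZMod n) : ℕ := Module.finrank k (N.InjectiveModule a)

/-- The map `ψ(a) = τ^{-q_a}(a)`, where `τ(a) = a + 1`. The coresolution quiver `R*_A` has vertex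
set `ZMod n` and exactly one arrow `a ⟶ ψ(a)` for every vertex `a`. -/
def ψ (a : ZMod n) : ZMod n := a - (N.q a : ZMod n)

/-- `p` is the number of vertices of a cycle of the coresolution quiver. -/
def IsCoresolutionPeriodicity (p : ℕ) : Prop :=
  ∃ c ∈ Function.periodicPts N.ψ, Function.minimalPeriod N.ψ c = p

/-- The set of vertices of the connected component of the coresolution quiver that contains `a`. -/
def coresolutionComponent (a : ZMod n) : Set (ZMod n) :=
  {b | Relation.EqvGen (fun x y => N.ψ x = y) a b}

end Presentation

end Nakayama

end

noncomputable section

namespace Nakayama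

/-! The nonzero paths form a basis of A. Writing c x = dim P_x, concatenation gives the Kupisch
inequality c x ≤ l + c (x + l). A nonzero quotient of P_x of length l is an interval [x, x + l), and
its syzygy is [x + l, x + c x) (`IsInterval.ker`). Put f x = x + c x on ℤ; this is monotone by the
Kupisch inequality. Two syzygies turn [x, x + 1) into [f x, f (x + 1)), so dim Ω^{2m}(S_x) = f^m (x
+ 1) - f^m x as long as no syzygy vanishes (`iterate_syzygyStep_two_mul`).

The map g y = y - dim I_y lifts ψ and is right adjoint to f: both f x ≤ y and x ≤ g y say that there
is no nonzero path from x to y (`galoisConnection_lift`). Hence g^m y = x exactly when f^m x ≤ y <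
f^m (x + 1), so dim Ω^{2m}(S_a) is the number of points of the fibre of ψ^m over a
(`ncard_iterate_eq`).

The rest is finite dynamics. Periodicity of the resolution makes every fibre nonempty, so a lies on
a cycle of ψ, and makes the fibre sizes repeat from r on. Then the fibres of ψ^r, …, ψ^{r+p-1} over
a partition the component of a (`sum_ncard_iterate_eq`). The number p may come from another cycle: ψ
lifts to a monotone map of degree one, so all cycles have equal length
(`minimalPeriod_dvd_minimalPeriod`). -/

/-- A basis of a `k`-algebra `A` consisting of the nonzero classes of the paths in `Δ_n`: the path
starting in `x` of length `l` has class `u x l`, which is nonzero exactly for `l < c x`. -/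
structure PathBasis (k : Type u) [Field k] (A : Type v) [Ring A] [Algebra k A]
    (n : ℕ) [NeZero n] where
  u : ZMod n → ℕ → A
  c : ZMod n → ℕ
  c_pos : ∀ x, 0 < c x
  u_mul : ∀ x l y m, u x l * u y m = if x + (l : ZMod n) = y then u x (l + m) else 0
  u_zero : ∀ x l, c x ≤ l → u x l = 0
  coord : ZMod n → ℕ → A →ₗ[k] k
  coord_u : ∀ x l y m, coord x l (u y m) = if y = x ∧ m = l ∧ l < c x then 1 else 0
  span_u : Submodule.span k (Set.range fun p : ZMod n × ℕ => u p.1 p.2) = ⊤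
  sum_u : ∑ x, u x 0 = 1

/-! ### The monomial relation ideal and the path basis of the quotient -/

namespace PathAlgebra

variable {k : Type u} [Field k] {n : ℕ}

/-- The coefficient of a path in an element of the path algebra. -/
def coeff (p : CyclePath n) : PathAlgebra k n →ₗ[k] k :=
  (Finsupp.lapply p : (CyclePath n →₀ k) →ₗ[k] k)

open Classical in
theorem coeff_ofPath (p q : CyclePath n) :
    coeff p (ofPath k q) = if q = p then 1 else 0 := by
  change (Finsupp.single q (1 : k)) p = _
  rw [Finsupp.single_apply]

theorem span_ofPath : Submodule.span k (Set.range (ofPath k (n := n))) = ⊤ := by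
  rw [← Submodule.ker_mkQ (Submodule.span k (Set.range (ofPath k (n := n)))), LinearMap.ker_eq_top]
  refine hom_ext fun p => ?_
  rw [LinearMap.zero_apply, Submodule.mkQ_apply, Submodule.Quotient.mk_eq_zero]
  exact Submodule.subset_span (Set.mem_range_self p)

open Classical in
theorem ofPath_mul [NeZero n] (p q : CyclePath n) :
    ofPath k p * ofPath k q =
      if p.target = q.source then ofPath k ⟨p.source, p.length + q.length⟩ else 0 :=
  mulHom_ofPath k n p q

end PathAlgebra

/-- A path contains one of the paths in `R` as a subpath. -/
def ContainsRelation {n : ℕ} (R : Finset (CyclePath n)) (p : CyclePath n) : Prop :=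
  ∃ r ∈ R, ∃ i : ℕ, p.source + (i : ZMod n) = r.source ∧ i + r.length ≤ p.length

section

variable {k : Type u} [Field k] {n : ℕ} [NeZero n] {R : Finset (CyclePath n)}

open PathAlgebra

theorem ofPath_mul_mem_span {p q : CyclePath n} (h : ContainsRelation R p ∨ ContainsRelation R q) :
    ofPath k p * ofPath k q ∈ Submodule.span k (ofPath k '' {p | ContainsRelation R p}) := by
  classical
  rw [ofPath_mul]
  split_ifs with hpq
  · refine Submodule.subset_span ⟨_, ?_, rfl⟩
    rcases h with ⟨r, hr, i, h1, h2⟩ | ⟨r, hr, i, h1, h2⟩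
    · exact ⟨r, hr, i, h1, by simp only; omega⟩
    · refine ⟨r, hr, p.length + i, ?_, by simp only; omega⟩
      rw [← h1, ← hpq, CyclePath.target]
      push_cast
      ring
  · exact zero_mem _

/-- A relation inside one factor is still a subpath of the concatenation, so the paths containing a
relation span a two-sided ideal. -/
theorem mul_mem_span_containsRelation {x y : PathAlgebra k n}
    (h : x ∈ Submodule.span k (ofPath k '' {p | ContainsRelation R p}) ∨
      y ∈ Submodule.span k (ofPath k '' {p | ContainsRelation R p})) :
    x * y ∈ Submodule.span k (ofPath k '' {p | ContainsRelation R p}) := by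
  have key : ∀ s t : Set (CyclePath n), (∀ p ∈ s, ∀ q ∈ t, ofPath k p * ofPath k q ∈
      Submodule.span k (ofPath k '' {p | ContainsRelation R p})) →
      x ∈ Submodule.span k (ofPath k '' s) → y ∈ Submodule.span k (ofPath k '' t) →
      x * y ∈ Submodule.span k (ofPath k '' {p | ContainsRelation R p}) := by
    intro s t hst hx hy
    have h := Submodule.mul_mem_mul hx hy
    rw [Submodule.span_mul_span] at h
    refine Submodule.span_le.2 ?_ h
    rintro _ ⟨_, ⟨p, hp, rfl⟩, _, ⟨q, hq, rfl⟩, rfl⟩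
    exact hst p hp q hq
  have htop : ∀ z : PathAlgebra k n, z ∈ Submodule.span k (ofPath k '' Set.univ) := by
    intro z
    rw [Set.image_univ, span_ofPath]
    trivial
  rcases h with h | h
  · exact key _ _ (fun p hp q _ => ofPath_mul_mem_span (Or.inl hp)) h (htop y)
  · exact key _ _ (fun p _ q hq => ofPath_mul_mem_span (Or.inr hq)) (htop x) h

theorem ofPath_mem_relationIdeal {p : CyclePath n} (h : ContainsRelation R p) :
    ofPath k p ∈ relationIdeal k R := by
  classical
  obtain ⟨r, hr, i, h1, h2⟩ := h
  have hmem : ofPath k r ∈ relationIdeal k R := TwoSidedIdeal.subset_span ⟨r, hr, rfl⟩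
  have e : ofPath k p = ofPath k ⟨p.source, i⟩ * ofPath k r *
      ofPath k ⟨r.target, p.length - (i + r.length)⟩ := by
    rw [ofPath_mul, if_pos (by exact h1), ofPath_mul, if_pos]
    · congr 1
      ext
      · rfl
      · simp only; omega
    · simp only [CyclePath.target]
      rw [← h1]
      push_cast
      ring
  rw [e]
  exact TwoSidedIdeal.mul_mem_right _ _ _ (TwoSidedIdeal.mul_mem_left _ _ _ hmem)

theorem mem_span_of_mem_relationIdeal {x : PathAlgebra k n} (h : x ∈ relationIdeal k R) :
    x ∈ Submodule.span k (ofPath k '' {p | ContainsRelation R p}) := by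
  let J : TwoSidedIdeal (PathAlgebra k n) := TwoSidedIdeal.mk'
    (Submodule.span k (ofPath k '' {p | ContainsRelation R p}) : Set (PathAlgebra k n))
    (zero_mem _) (fun hx hy => add_mem hx hy) (fun hx => neg_mem hx)
    (fun hy => mul_mem_span_containsRelation (Or.inr hy))
    (fun hx => mul_mem_span_containsRelation (Or.inl hx))
  have hJ : relationIdeal k R ≤ J := by
    refine TwoSidedIdeal.span_le.2 ?_
    rintro _ ⟨r, hr, rfl⟩
    refine (TwoSidedIdeal.mem_mk' _ _ _ _ _ _ _).2 (Submodule.subset_span ⟨r, ⟨r, hr, 0, ?_, ?_⟩, rfl⟩)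
    · simp
    · simp
  exact (TwoSidedIdeal.mem_mk' _ _ _ _ _ _ _).1 (hJ h)

theorem coeff_eq_zero_of_mem_relationIdeal {x : PathAlgebra k n} (h : x ∈ relationIdeal k R)
    {p : CyclePath n} (hp : ¬ ContainsRelation R p) : coeff p x = 0 := by
  classical
  have : Submodule.span k (ofPath k '' {p | ContainsRelation R p}) ≤
      LinearMap.ker (coeff p : PathAlgebra k n →ₗ[k] k) := by
    refine Submodule.span_le.2 ?_
    rintro _ ⟨q, hq, rfl⟩
    rw [SetLike.mem_coe, LinearMap.mem_ker, coeff_ofPath, if_neg]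
    rintro rfl
    exact hp hq
  exact this (mem_span_of_mem_relationIdeal h)

end

namespace Presentation

variable {k : Type u} [Field k] {A : Type v} [Ring A] [Algebra k A] {n : ℕ} [NeZero n]
  (N : Presentation k A n)

/-- The projection from the path algebra. -/
def proj : PathAlgebra k n →ₐ[k] A :=
  N.iso.symm.toAlgHom.comp ((relationIdeal k N.relations).ringCon.mkₐ (α := k))

theorem proj_surjective : Function.Surjective N.proj :=
  N.iso.symm.surjective.comp (RingCon.mkₐ_surjective (α := k) _)

theorem proj_eq_zero_iff (x : PathAlgebra k n) : N.proj x = 0 ↔ x ∈ relationIdeal k N.relations := by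
  change N.iso.symm ((x : (relationIdeal k N.relations).ringCon.Quotient)) = 0 ↔ _
  rw [EmbeddingLike.map_eq_zero_iff, TwoSidedIdeal.mem_iff, ← RingCon.eq]
  rfl

/-- The coefficient functional of a path that contains no relation. -/
def coord (p : CyclePath n) (hp : ¬ ContainsRelation N.relations p) : A →ₗ[k] k :=
  ((LinearMap.ker N.proj.toLinearMap).liftQ (PathAlgebra.coeff p) fun x hx =>
    coeff_eq_zero_of_mem_relationIdeal ((N.proj_eq_zero_iff x).1 hx) hp) ∘ₗ
  (N.proj.toLinearMap.quotKerEquivOfSurjective N.proj_surjective).symm.toLinearMap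

theorem coord_proj (p : CyclePath n) (hp : ¬ ContainsRelation N.relations p)
    (x : PathAlgebra k n) : N.coord p hp (N.proj x) = PathAlgebra.coeff p x := by
  have : (N.proj.toLinearMap.quotKerEquivOfSurjective N.proj_surjective).symm (N.proj x) =
      Submodule.Quotient.mk x := by
    rw [LinearEquiv.symm_apply_eq]
    rfl
  rw [coord, LinearMap.comp_apply]
  erw [this]
  rfl

theorem containsRelation_mono {x : ZMod n} {l m : ℕ} (h : l ≤ m)
    (hl : ContainsRelation N.relations ⟨x, l⟩) : ContainsRelation N.relations ⟨x, m⟩ := by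
  obtain ⟨r, hr, i, h1, h2⟩ := hl
  exact ⟨r, hr, i, h1, le_trans h2 h⟩

/-- Otherwise the paths of all lengths starting at x would be linearly independent in A; finite
dimension enters here. -/
theorem exists_containsRelation [FiniteDimensional k A] (x : ZMod n) :
    ∃ l, ContainsRelation N.relations ⟨x, l⟩ := by
  classical
  by_contra! hx
  have hli : LinearIndependent k fun l : ℕ => N.proj (PathAlgebra.ofPath k ⟨x, l⟩) := by
    rw [linearIndependent_iff']
    intro s g hg i hi
    have := congrArg (N.coord ⟨x, i⟩ (hx i)) hg
    simpa [coord_proj, PathAlgebra.coeff_ofPath, hi] using this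
  exact not_finite_iff_infinite.2 (inferInstanceAs (Infinite ℕ)) hli.finite

open Classical in
/-- The dimension of the projective module `P_x`. -/
def c [FiniteDimensional k A] (x : ZMod n) : ℕ := Nat.find (N.exists_containsRelation x)

theorem containsRelation_iff [FiniteDimensional k A] (x : ZMod n) (l : ℕ) :
    ContainsRelation N.relations ⟨x, l⟩ ↔ N.c x ≤ l := by
  classical
  exact ⟨fun h => Nat.find_min' _ h,
    fun h => N.containsRelation_mono h (Nat.find_spec (N.exists_containsRelation x))⟩

open Classical in
/-- The basis of a Nakayama algebra given by its nonzero paths. -/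
def pathBasis [FiniteDimensional k A] : PathBasis k A n where
  u x l := N.proj (PathAlgebra.ofPath k ⟨x, l⟩)
  c := N.c
  c_pos x := by
    rw [Nat.pos_iff_ne_zero]
    intro h
    obtain ⟨r, hr, i, -, h2⟩ := (N.containsRelation_iff x 0).2 h.le
    have := N.nontrivial r hr
    simp only at h2
    omega
  u_mul x l y m := by
    rw [← map_mul, PathAlgebra.ofPath_mul]
    by_cases h : x + (l : ZMod n) = y
    · rw [if_pos h, if_pos (by exact h)]
    · rw [if_neg h, if_neg (by exact h), map_zero]
  u_zero x l h :=
    (N.proj_eq_zero_iff _).2 (ofPath_mem_relationIdeal ((N.containsRelation_iff x l).2 h))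
  coord x l := if h : ContainsRelation N.relations ⟨x, l⟩ then 0 else N.coord ⟨x, l⟩ h
  coord_u x l y m := by
    split_ifs with h1 h2 h2
    · exact absurd ((N.containsRelation_iff x l).1 h1) (by omega)
    · rfl
    · rw [coord_proj, PathAlgebra.coeff_ofPath, if_pos]
      rw [h2.1, h2.2.1]
    · rw [coord_proj, PathAlgebra.coeff_ofPath, if_neg]
      rintro ⟨⟩
      rw [containsRelation_iff, not_le] at h1
      exact h2 ⟨rfl, rfl, h1⟩
  span_u := by
    have h := congrArg (Submodule.map N.proj.toLinearMap) (PathAlgebra.span_ofPath (k := k) (n := n))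
    rw [Submodule.map_span, Submodule.map_top, LinearMap.range_eq_top.2 N.proj_surjective] at h
    rw [← h]
    congr 1
    ext z
    constructor
    · rintro ⟨p, rfl⟩
      exact ⟨_, ⟨⟨p.1, p.2⟩, rfl⟩, rfl⟩
    · rintro ⟨_, ⟨p, rfl⟩, rfl⟩
      exact ⟨(p.1, p.2), rfl⟩
  sum_u := by
    rw [← map_sum, ← PathAlgebra.one_def, map_one]

end Presentation

/-! ### Coordinates, and right and left ideals generated by paths -/

namespace PathBasis

variable {k : Type u} [Field k] {A : Type v} [Ring A] [Algebra k A] {n : ℕ} [NeZero n]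
  (W : PathBasis k A n)

theorem hom_ext {M : Type*} [AddCommGroup M] [Module k M] {f g : A →ₗ[k] M}
    (h : ∀ x l, f (W.u x l) = g (W.u x l)) : f = g :=
  LinearMap.ext_on W.span_u (by rintro _ ⟨p, rfl⟩; exact h _ _)

theorem u_eq_zero_iff (x : ZMod n) (l : ℕ) : W.u x l = 0 ↔ W.c x ≤ l := by
  refine ⟨fun h => ?_, W.u_zero x l⟩
  by_contra! hl
  have := W.coord_u x l x l
  rw [h, map_zero, if_pos ⟨rfl, rfl, hl⟩] at this
  exact zero_ne_one this

theorem u_mul_u (x : ZMod n) (l m : ℕ) : W.u x l * W.u (x + l) m = W.u x (l + m) := by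
  rw [W.u_mul, if_pos rfl]

/-- The Kupisch inequality. -/
theorem c_le_add (x : ZMod n) (l : ℕ) : W.c x ≤ l + W.c (x + l) := by
  rw [← W.u_eq_zero_iff, ← W.u_mul_u, W.u_zero _ _ le_rfl, mul_zero]

theorem sum_coord (b : A) :
    ∑ x, ∑ l ∈ Finset.range (W.c x), W.coord x l b • W.u x l = b := by
  let f : A →ₗ[k] A :=
    ∑ x, ∑ l ∈ Finset.range (W.c x), (W.coord x l).smulRight (W.u x l)
  have hf : f = LinearMap.id := by
    refine W.hom_ext fun y m => ?_
    simp only [f, LinearMap.sum_apply, LinearMap.smulRight_apply, LinearMap.id_apply]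
    rw [Finset.sum_eq_single y]
    · by_cases hm : m < W.c y
      · rw [Finset.sum_eq_single m]
        · simp [W.coord_u, hm]
        · intro l _ hl
          simp [W.coord_u, hl.symm]
        · simp [hm]
      · rw [W.u_zero y m (not_lt.1 hm)]
        simp
    · intro x _ hx
      simp [W.coord_u, hx.symm]
    · simp
  have := LinearMap.congr_fun hf b
  simpa [f] using this

theorem coord_eq_zero {x : ZMod n} {l : ℕ} (h : W.c x ≤ l) (b : A) : W.coord x l b = 0 := by
  have : W.coord x l = 0 := W.hom_ext fun y m => by
    rw [W.coord_u, if_neg (by omega), LinearMap.zero_apply]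
  rw [this, LinearMap.zero_apply]

theorem ext_coord {b b' : A} (h : ∀ x l, l < W.c x → W.coord x l b = W.coord x l b') : b = b' := by
  rw [← W.sum_coord b, ← W.sum_coord b']
  refine Finset.sum_congr rfl fun x _ => Finset.sum_congr rfl fun l hl => ?_
  rw [h x l (Finset.mem_range.1 hl)]

/-- The guard m < c x matters: P_{x+l} may be longer than c x - l, and the excess is killed by `u x
l`. -/
theorem coord_u_mul (x : ZMod n) (l : ℕ) (y : ZMod n) (m : ℕ) (b : A) :
    W.coord y m (W.u x l * b) =
      if y = x ∧ l ≤ m ∧ m < W.c x then W.coord (x + l) (m - l) b else 0 := by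
  split_ifs with h
  · obtain ⟨rfl, h1, h2⟩ := h
    have : W.coord y m ∘ₗ LinearMap.mulLeft k (W.u y l) = W.coord (y + l) (m - l) := by
      refine W.hom_ext fun z j => ?_
      have := W.c_le_add y l
      rw [LinearMap.comp_apply, LinearMap.mulLeft_apply, W.u_mul, W.coord_u]
      by_cases hz : y + (l : ZMod n) = z
      · rw [if_pos hz, W.coord_u]
        congr 1
        simp only [hz, true_and, eq_iff_iff]
        subst hz
        omega
      · rw [if_neg hz, map_zero, if_neg]
        rintro ⟨rfl, -⟩
        exact hz rfl
    exact LinearMap.congr_fun this b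
  · have : W.coord y m ∘ₗ LinearMap.mulLeft k (W.u x l) = 0 := by
      refine W.hom_ext fun z j => ?_
      rw [LinearMap.comp_apply, LinearMap.mulLeft_apply, W.u_mul, LinearMap.zero_apply]
      split_ifs with hz
      · rw [W.coord_u, if_neg]
        rintro ⟨rfl, h1, h2⟩
        exact h ⟨rfl, by omega, h2⟩
      · exact map_zero _
    exact LinearMap.congr_fun this b

theorem coord_mul_u_zero (x : ZMod n) (y : ZMod n) (m : ℕ) (b : A) :
    W.coord y m (b * W.u x 0) = if y + m = x then W.coord y m b else 0 := by
  have : W.coord y m ∘ₗ LinearMap.mulRight k (W.u x 0) =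
      if y + m = x then W.coord y m else 0 := by
    refine W.hom_ext fun z j => ?_
    rw [LinearMap.comp_apply, LinearMap.mulRight_apply, W.u_mul]
    split_ifs with h1 h2 h2
    · rfl
    · rw [LinearMap.zero_apply, add_zero, W.coord_u, if_neg]
      rintro ⟨rfl, rfl, -⟩
      exact h2 h1
    · rw [map_zero, W.coord_u, if_neg]
      rintro ⟨rfl, rfl, -⟩
      exact h1 h2
    · simp
  have := LinearMap.congr_fun this b
  rw [LinearMap.comp_apply, LinearMap.mulRight_apply] at this
  rw [this]
  split_ifs <;> rfl

/-- The right ideal generated by a path. -/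
def rightIdeal (x : ZMod n) (l : ℕ) : Submodule Aᵐᵒᵖ A := Submodule.span Aᵐᵒᵖ {W.u x l}

theorem mem_rightIdeal_iff_mul {x : ZMod n} {l : ℕ} {b : A} :
    b ∈ W.rightIdeal x l ↔ ∃ a, W.u x l * a = b := by
  rw [rightIdeal, Submodule.mem_span_singleton]
  exact ⟨fun ⟨a, h⟩ => ⟨a.unop, h⟩, fun ⟨a, h⟩ => ⟨MulOpposite.op a, h⟩⟩

theorem mem_rightIdeal_iff {x : ZMod n} {l : ℕ} {b : A} :
    b ∈ W.rightIdeal x l ↔ ∀ y m, (y ≠ x ∨ m < l) → W.coord y m b = 0 := by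
  rw [mem_rightIdeal_iff_mul]
  constructor
  · rintro ⟨a, rfl⟩ y m h
    rw [coord_u_mul, if_neg]
    rintro ⟨h1, h2, -⟩
    exact h.elim (· h1) (by omega)
  · intro h
    -- Divide b by `u x l` term by term: strip the first l arrows from each path.
    refine ⟨∑ m ∈ Finset.Ico l (W.c x), W.coord x m b • W.u (x + l) (m - l), ?_⟩
    rw [Finset.mul_sum]
    conv_rhs => rw [← W.sum_coord b]
    rw [Finset.sum_eq_single x]
    · symm
      rw [Finset.range_eq_Ico]
      refine Finset.sum_subset_zero_on_sdiff ?_ ?_ ?_ |>.symm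
      · exact Finset.Ico_subset_Ico_left (Nat.zero_le _)
      · intro m hm
        simp only [Finset.mem_sdiff, Finset.mem_Ico] at hm
        rw [h x m (Or.inr (by omega)), zero_smul]
      · intro m hm
        rw [Finset.mem_Ico] at hm
        rw [mul_smul_comm, u_mul_u, Nat.add_sub_cancel' hm.1]
    · intro y _ hy
      exact Finset.sum_eq_zero fun m _ => by rw [h y m (Or.inl hy), zero_smul]
    · simp

theorem mem_leftIdeal_iff {x : ZMod n} {b : A} :
    b ∈ (Submodule.span A {W.u x 0} : Submodule A A) ↔
      ∀ (y : ZMod n) (m : ℕ), y + (m : ZMod n) ≠ x → W.coord y m b = 0 := by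
  rw [Submodule.mem_span_singleton]
  constructor
  · rintro ⟨a, rfl⟩ y m h
    rw [smul_eq_mul, coord_mul_u_zero, if_neg h]
  · intro h
    refine ⟨b, W.ext_coord fun y m _ => ?_⟩
    rw [smul_eq_mul, coord_mul_u_zero]
    split_ifs with h1
    · rfl
    · rw [h y m h1]

/-- A subspace cut out by the vanishing of coordinates outside `s` has dimension `s.card`. -/
theorem finrank_eq_card (s : Finset (ZMod n × ℕ)) (hs : ∀ p ∈ s, p.2 < W.c p.1)
    (V : Submodule k A) (hV : ∀ b, b ∈ V ↔ ∀ x l, (x, l) ∉ s → W.coord x l b = 0) :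
    Module.finrank k V = s.card := by
  have hspan : V = Submodule.span k (Set.range fun p : s => W.u p.1.1 p.1.2) := by
    apply le_antisymm
    · intro b hb
      rw [← W.sum_coord b]
      refine sum_mem fun x _ => sum_mem fun l _ => ?_
      by_cases h : (x, l) ∈ s
      · exact Submodule.smul_mem _ _ (Submodule.subset_span ⟨⟨(x, l), h⟩, rfl⟩)
      · rw [(hV b).1 hb x l h, zero_smul]
        exact zero_mem _
    · refine Submodule.span_le.2 ?_
      rintro _ ⟨⟨⟨y, m⟩, h⟩, rfl⟩
      refine (hV _).2 fun x l hxl => ?_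
      rw [W.coord_u, if_neg]
      rintro ⟨rfl, rfl, -⟩
      exact hxl h
  have hli : LinearIndependent k fun p : s => W.u p.1.1 p.1.2 := by
    rw [linearIndependent_iff']
    intro t g hg p hp
    have := congrArg (W.coord p.1.1 p.1.2) hg
    rw [map_sum, map_zero, Finset.sum_eq_single p] at this
    · simpa [W.coord_u, hs p.1 p.2] using this
    · intro q _ hq
      rw [map_smul, W.coord_u, if_neg, smul_zero]
      rintro ⟨h1, h2, -⟩
      exact hq (Subtype.ext (Prod.ext h1 h2))
    · exact fun h => absurd hp h
  rw [hspan, finrank_span_eq_card hli, Fintype.card_coe]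

theorem finrank_rightIdeal (x : ZMod n) (l : ℕ) :
    Module.finrank k (W.rightIdeal x l) = W.c x - l := by
  have := W.finrank_eq_card ((Finset.Ico l (W.c x)).image fun m => (x, m)) ?_
    ((W.rightIdeal x l).restrictScalars k) ?_
  · rw [Finset.card_image_of_injective _ (Prod.mk_right_injective x), Nat.card_Ico] at this
    exact this
  · intro p hp
    simp only [Finset.mem_image, Finset.mem_Ico] at hp
    obtain ⟨m, hm, rfl⟩ := hp
    exact hm.2
  · intro b
    rw [Submodule.restrictScalars_mem, mem_rightIdeal_iff]
    constructor
    · intro h y m hm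
      rcases lt_or_ge m (W.c y) with hc | hc
      · refine h y m ?_
        by_contra! hy
        exact hm (Finset.mem_image.2 ⟨m, Finset.mem_Ico.2 ⟨hy.2, hy.1 ▸ hc⟩, by rw [hy.1]⟩)
      · exact W.coord_eq_zero hc b
    · intro h y m hm
      refine h y m ?_
      simp only [Finset.mem_image, Finset.mem_Ico, Prod.mk.injEq, not_exists, not_and]
      rintro m' h1 rfl rfl
      rcases hm with hm | hm
      · exact hm rfl
      · omega

/-- A path of length j ending at x starts at x - j; C only serves to make the range of lengths
finite. -/
theorem finrank_leftIdeal (x : ZMod n) (C : ℕ) (hC : ∀ y, W.c y ≤ C) :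
    Module.finrank k (Submodule.span A {W.u x 0} : Submodule A A) =
      ((Finset.range C).filter fun j : ℕ => j < W.c (x - (j : ZMod n))).card := by
  have := W.finrank_eq_card
    (((Finset.range C).filter fun j : ℕ => j < W.c (x - j)).image fun j : ℕ => (x - (j : ZMod n), j)) ?_
    ((Submodule.span A {W.u x 0} : Submodule A A).restrictScalars k) ?_
  · rw [Finset.card_image_of_injective _ fun i j h => (Prod.ext_iff.1 h).2] at this
    exact this
  · intro p hp
    simp only [Finset.mem_image, Finset.mem_filter] at hp
    obtain ⟨m, hm, rfl⟩ := hp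
    exact hm.2
  · intro b
    rw [Submodule.restrictScalars_mem, mem_leftIdeal_iff]
    constructor
    · intro h y m hm
      rcases lt_or_ge m (W.c y) with hc | hc
      · refine h y m ?_
        rintro rfl
        refine hm (Finset.mem_image.2 ⟨m, Finset.mem_filter.2 ⟨Finset.mem_range.2 ?_, ?_⟩, ?_⟩)
        · exact lt_of_lt_of_le hc (hC y)
        · rwa [add_sub_cancel_right]
        · rw [add_sub_cancel_right]
      · exact W.coord_eq_zero hc b
    · intro h y m hm
      refine h y m ?_
      simp only [Finset.mem_image, Prod.mk.injEq, not_exists, not_and]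
      rintro m' h1 rfl rfl
      exact hm (sub_add_cancel _ _)

theorem rightIdeal_anti (x : ZMod n) {l m : ℕ} (h : l ≤ m) :
    W.rightIdeal x m ≤ W.rightIdeal x l := by
  intro b hb
  rw [mem_rightIdeal_iff] at hb ⊢
  exact fun y j hj => hb y j (hj.imp id (by omega))

theorem rightIdeal_eq_bot {x : ZMod n} {l : ℕ} (h : W.c x ≤ l) : W.rightIdeal x l = ⊥ := by
  rw [rightIdeal, W.u_zero x l h, Submodule.span_zero_singleton]

theorem u_mem_rightIdeal (x : ZMod n) (l : ℕ) : W.u x l ∈ W.rightIdeal x l :=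
  Submodule.mem_span_singleton_self _

theorem mul_u_mem_rightIdeal {x : ZMod n} {l : ℕ} {b : A} (hb : b ∈ W.rightIdeal x l)
    (y : ZMod n) (m : ℕ) : b * W.u y m ∈ W.rightIdeal x (l + m) := by
  obtain ⟨a, rfl⟩ := W.mem_rightIdeal_iff_mul.1 hb
  have : ((W.rightIdeal x (l + m)).restrictScalars k).mkQ ∘ₗ LinearMap.mulRight k (W.u y m) ∘ₗ
      LinearMap.mulLeft k (W.u x l) = 0 := by
    refine W.hom_ext fun z j => ?_
    simp only [LinearMap.comp_apply, LinearMap.mulRight_apply, LinearMap.mulLeft_apply,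
      LinearMap.zero_apply, Submodule.mkQ_apply, Submodule.Quotient.mk_eq_zero,
      Submodule.restrictScalars_mem, W.u_mul]
    split_ifs with h1
    · rw [W.u_mul]
      split_ifs
      · exact W.rightIdeal_anti x (by omega) (W.u_mem_rightIdeal x _)
      · exact zero_mem _
    · rw [zero_mul]
      exact zero_mem _
  have := LinearMap.congr_fun this a
  simpa using this

/-- The proper submodules of `P_x` generated by paths are superfluous. -/
theorem rightIdeal_zero_le_of_sup {x : ZMod n} {L : Submodule Aᵐᵒᵖ A}
    (h : W.rightIdeal x 0 ≤ W.rightIdeal x 1 ⊔ L) : W.rightIdeal x 0 ≤ L := by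
  obtain ⟨w, hw, z, hz, hwz⟩ := Submodule.mem_sup.1 (h (W.u_mem_rightIdeal x 0))
  -- Descending induction from length c x, where the ideal is zero: in u x m = w * u x m + z * u x m
  -- the first term lies one step deeper, the second in L.
  have step : ∀ m, W.rightIdeal x (m + 1) ≤ L → W.rightIdeal x m ≤ L := by
    intro m hm
    refine (Submodule.span_singleton_le_iff_mem _ _).2 ?_
    have e : W.u x m = w * W.u x m + MulOpposite.op (W.u x m) • z := by
      rw [show MulOpposite.op (W.u x m) • z = z * W.u x m from rfl, ← add_mul, hwz]
      have := W.u_mul_u x 0 m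
      simpa using this.symm
    rw [e]
    refine add_mem (hm ?_) (L.smul_mem _ hz)
    rw [add_comm]
    exact W.mul_u_mem_rightIdeal hw x m
  have : ∀ d m, W.c x ≤ m + d → W.rightIdeal x m ≤ L := by
    intro d
    induction d with
    | zero => intro m hm; rw [W.rightIdeal_eq_bot (by simpa using hm)]; exact bot_le
    | succ d ih => intro m hm; exact step m (ih (m + 1) (by omega))
  exact this _ 0 (Nat.le_add_left _ _)

/-- Left multiplication by an element, as an endomorphism of the right regular module. -/
def mulLeftOp (a : A) : A →ₗ[Aᵐᵒᵖ] A where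
  toFun b := a * b
  map_add' := mul_add a
  map_smul' r b := (mul_assoc a b r.unop).symm

theorem u_zero_mul {x : ZMod n} {l : ℕ} {b : A} (hb : b ∈ W.rightIdeal x l) :
    W.u x 0 * b = b := by
  obtain ⟨a, rfl⟩ := W.mem_rightIdeal_iff_mul.1 hb
  have := W.u_mul_u x 0 l
  rw [← mul_assoc]
  congr 1
  simpa using this

/-- Left multiplication by the idempotent `u x 0` splits the inclusion into A. -/
theorem projective_rightIdeal (x : ZMod n) : Module.Projective Aᵐᵒᵖ (W.rightIdeal x 0) := by
  have : Module.Projective Aᵐᵒᵖ A :=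
    Module.Projective.of_equiv
      ({ (MulOpposite.opAddEquiv (α := A)).symm with map_smul' := fun _ _ => rfl } : Aᵐᵒᵖ ≃ₗ[Aᵐᵒᵖ] A)
  refine Module.Projective.of_split (W.rightIdeal x 0).subtype
    ((mulLeftOp (W.u x 0)).codRestrict _ fun b => W.mem_rightIdeal_iff_mul.2 ⟨b, rfl⟩) ?_
  ext b
  exact W.u_zero_mul b.2

theorem u_mul_eq_zero_iff {x : ZMod n} {l : ℕ} {b : A} (hb : b ∈ W.rightIdeal (x + l) 0) :
    W.u x l * b = 0 ↔ b ∈ W.rightIdeal (x + l) (W.c x - l) := by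
  rw [mem_rightIdeal_iff] at hb ⊢
  constructor
  · intro h y m hym
    by_cases hy : y = x + l
    · subst hy
      have hm : m < W.c x - l := hym.resolve_left (not_not_intro rfl)
      have := congrArg (W.coord x (l + m)) h
      rwa [map_zero, coord_u_mul, if_pos ⟨rfl, by omega, by omega⟩, Nat.add_sub_cancel_left] at this
    · exact hb y m (Or.inl hy)
  · intro h
    refine W.ext_coord fun y m _ => ?_
    rw [coord_u_mul, map_zero]
    split_ifs with hm
    · exact h _ _ (Or.inr (by omega))
    · rfl

/-! ### Interval modules and their syzygies -/

/-- The module `M` is isomorphic to the quotient of length `l` of `P_x`. -/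
def IsInterval (M : Type*) [AddCommGroup M] [Module Aᵐᵒᵖ M] (s : ZMod n × ℕ) : Prop :=
  s.2 ≤ W.c s.1 ∧ ∃ π : W.rightIdeal s.1 0 →ₗ[Aᵐᵒᵖ] M, Function.Surjective π ∧
    ∀ b, π b = 0 ↔ (b : A) ∈ W.rightIdeal s.1 s.2

variable {W}

theorem IsInterval.of_equiv {M M' : Type*} [AddCommGroup M] [Module Aᵐᵒᵖ M] [AddCommGroup M']
    [Module Aᵐᵒᵖ M'] {s : ZMod n × ℕ} (h : W.IsInterval M s) (e : M ≃ₗ[Aᵐᵒᵖ] M') :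
    W.IsInterval M' s := by
  obtain ⟨hl, π, hπ, hk⟩ := h
  refine ⟨hl, e.toLinearMap ∘ₗ π, e.surjective.comp hπ, fun b => ?_⟩
  rw [← hk, LinearMap.comp_apply, LinearEquiv.coe_coe, EmbeddingLike.map_eq_zero_iff]

theorem isInterval_of_subsingleton {M : Type*} [AddCommGroup M] [Module Aᵐᵒᵖ M] [Subsingleton M]
    (x : ZMod n) : W.IsInterval M (x, 0) :=
  ⟨Nat.zero_le _, 0, fun _ => ⟨0, Subsingleton.elim _ _⟩, fun b => ⟨fun _ => b.2, fun _ => rfl⟩⟩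

theorem IsInterval.subsingleton {M : Type*} [AddCommGroup M] [Module Aᵐᵒᵖ M] {x : ZMod n}
    (h : W.IsInterval M (x, 0)) : Subsingleton M := by
  obtain ⟨-, π, hπ, hk⟩ := h
  refine subsingleton_of_forall_eq 0 fun m => ?_
  obtain ⟨b, rfl⟩ := hπ m
  exact (hk b).2 b.2

theorem IsInterval.finrank_eq [FiniteDimensional k A] {M : Type*} [AddCommGroup M]
    [Module Aᵐᵒᵖ M] [Module k M] [IsScalarTower k Aᵐᵒᵖ M] {s : ZMod n × ℕ}
    (h : W.IsInterval M s) : Module.finrank k M = s.2 := by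
  obtain ⟨hl, π, hπ, hk⟩ := h
  have : FiniteDimensional k (W.rightIdeal s.1 0) :=
    inferInstanceAs (FiniteDimensional k ((W.rightIdeal s.1 0).restrictScalars k))
  let f : W.rightIdeal s.1 0 →ₗ[k] M := π.restrictScalars k
  have h1 := f.finrank_range_add_finrank_ker
  rw [LinearMap.range_eq_top.2 (show Function.Surjective f from hπ), finrank_top,
    W.finrank_rightIdeal] at h1
  have e : LinearMap.ker f ≃ₗ[k] W.rightIdeal s.1 s.2 :=
    { toFun := fun b => ⟨b.1.1, (hk b.1).1 b.2⟩
      invFun := fun b => ⟨⟨b.1, W.rightIdeal_anti _ (Nat.zero_le _) b.2⟩, (hk _).2 b.2⟩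
      map_add' := fun _ _ => rfl
      map_smul' := fun _ _ => rfl
      left_inv := fun _ => rfl
      right_inv := fun _ => rfl }
  rw [e.finrank_eq, W.finrank_rightIdeal] at h1
  omega

theorem IsInterval.dim_eq [FiniteDimensional k A] {M : ModuleCat.{v} Aᵐᵒᵖ} {s : ZMod n × ℕ}
    (h : W.IsInterval M s) : dim k A M = s.2 := by
  let _ := Module.restrictScalars k Aᵐᵒᵖ M
  have : IsScalarTower k Aᵐᵒᵖ M := IsScalarTower.restrictScalars k Aᵐᵒᵖ M
  exact h.finrank_eq

variable (W) in
/-- The effect of the syzygy on the invariants of an interval module. -/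
def syzygyStep (s : ZMod n × ℕ) : ZMod n × ℕ :=
  -- Length 0 is the zero module, whose syzygy is again zero; the general formula would give length
  -- c.
  if s.2 = 0 then s else (s.1 + s.2, W.c s.1 - s.2)

/-- X is identified with P_x by uniqueness of projective covers; then ker ε becomes u x l * A, the
image of P_{x+l} under left multiplication by `u x l`. -/
theorem IsInterval.ker {M X : Type v} [AddCommGroup M] [Module Aᵐᵒᵖ M] [AddCommGroup X]
    [Module Aᵐᵒᵖ X] [Module.Projective Aᵐᵒᵖ X] {s : ZMod n × ℕ} (h : W.IsInterval M s)
    (ε : X →ₗ[Aᵐᵒᵖ] M) (hε : Function.Surjective ε) (hs : IsSuperfluous (LinearMap.ker ε)) :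
    W.IsInterval (LinearMap.ker ε) (W.syzygyStep s) := by
  obtain ⟨x, l⟩ := s
  rw [syzygyStep]
  split_ifs with hl0
  · obtain rfl : l = 0 := hl0
    have := h.subsingleton
    have hk : LinearMap.ker ε = ⊤ := by
      rw [LinearMap.ker_eq_top]
      ext b
      exact Subsingleton.elim _ _
    have hb : (⊥ : Submodule Aᵐᵒᵖ X) = ⊤ := hs ⊥ (by rw [hk, sup_bot_eq])
    have : Subsingleton (LinearMap.ker ε) := by
      rw [hk, ← hb]
      infer_instance
    exact isInterval_of_subsingleton x
  obtain ⟨hl, π, hπ, hk⟩ := h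
  simp only at hl0 hl hk
  have := W.projective_rightIdeal x
  obtain ⟨φ, hφ⟩ := Module.projective_lifting_property ε π hε
  have hφ' : ∀ b, ε (φ b) = π b := LinearMap.congr_fun hφ
  -- The range of φ and the superfluous kernel of ε together fill X.
  have hφs : Function.Surjective φ := by
    rw [← LinearMap.range_eq_top]
    refine hs _ ((Submodule.eq_top_iff').2 fun y => ?_)
    obtain ⟨b, hb⟩ := hπ (ε y)
    rw [← sub_add_cancel y (φ b)]
    refine Submodule.add_mem_sup ?_ ⟨b, rfl⟩
    rw [LinearMap.mem_ker, map_sub, hφ', hb, sub_self]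
  obtain ⟨σ, hσ⟩ := Module.projective_lifting_property φ LinearMap.id hφs
  have hσ' : ∀ y, φ (σ y) = y := LinearMap.congr_fun hσ
  -- Since b - σ (φ b) lies in ker π, hence in the radical of P_x when l ≥ 1, the range of σ is
  -- everything by superfluity.
  have hσs : Function.Surjective σ := by
    have key : W.rightIdeal x 0 ≤ (LinearMap.range σ).map (W.rightIdeal x 0).subtype := by
      refine W.rightIdeal_zero_le_of_sup fun b hb => ?_
      have e : b = (b - (σ (φ ⟨b, hb⟩) : A)) + (σ (φ ⟨b, hb⟩) : A) := (sub_add_cancel _ _).symm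
      rw [e]
      refine Submodule.add_mem_sup ?_ ⟨_, ⟨_, rfl⟩, rfl⟩
      refine W.rightIdeal_anti x (Nat.one_le_iff_ne_zero.2 hl0) ((hk (⟨b, hb⟩ - σ (φ ⟨b, hb⟩))).1 ?_)
      rw [← hφ', map_sub, hσ', sub_self, map_zero]
    intro b
    obtain ⟨_, ⟨y, rfl⟩, hy⟩ := key b.2
    exact ⟨y, Subtype.ext hy⟩
  have hφi : ∀ b, φ b = 0 → b = 0 := by
    intro b hb
    obtain ⟨y, rfl⟩ := hσs b
    rw [hσ'] at hb
    rw [hb, map_zero]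
  have hmem : ∀ b, W.u x l * b ∈ W.rightIdeal x l := fun b => W.mem_rightIdeal_iff_mul.2 ⟨b, rfl⟩
  let lam : W.rightIdeal (x + l) 0 →ₗ[Aᵐᵒᵖ] W.rightIdeal x 0 :=
    ((mulLeftOp (W.u x l)).codRestrict (W.rightIdeal x 0) fun b =>
      W.rightIdeal_anti x (Nat.zero_le _) (hmem b)) ∘ₗ (W.rightIdeal (x + l) 0).subtype
  have hlam : ∀ b, (lam b : A) = W.u x l * b := fun _ => rfl
  refine ⟨?_, (φ ∘ₗ lam).codRestrict _ fun b => ?_, ?_, fun b => ?_⟩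
  · have := W.c_le_add x l
    simp only
    omega
  · rw [LinearMap.mem_ker, LinearMap.comp_apply, hφ', hk, hlam]
    exact hmem _
  · rintro ⟨y, hy⟩
    obtain ⟨b, rfl⟩ := hφs y
    rw [LinearMap.mem_ker, hφ', hk, mem_rightIdeal_iff_mul] at hy
    obtain ⟨a, ha⟩ := hy
    refine ⟨⟨W.u (x + l) 0 * a, W.mem_rightIdeal_iff_mul.2 ⟨a, rfl⟩⟩, Subtype.ext ?_⟩
    change φ (lam _) = φ b
    congr 1
    refine Subtype.ext ?_
    rw [hlam, ← ha, ← mul_assoc, u_mul_u, add_zero]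
  · rw [← W.u_mul_eq_zero_iff b.2, ← hlam, ZeroMemClass.coe_eq_zero, ← Subtype.coe_inj]
    change φ (lam b) = 0 ↔ _
    exact ⟨hφi _, fun h => by rw [h, map_zero]⟩

theorem IsInterval.ker_of_exact {X Y Z : Type v} [AddCommGroup X] [Module Aᵐᵒᵖ X]
    [Module.Projective Aᵐᵒᵖ X] [AddCommGroup Y] [Module Aᵐᵒᵖ Y] [AddCommGroup Z] [Module Aᵐᵒᵖ Z]
    {s : ZMod n × ℕ} {f : X →ₗ[Aᵐᵒᵖ] Y} {g : Y →ₗ[Aᵐᵒᵖ] Z} (hfg : Function.Exact f g)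
    (h : W.IsInterval (LinearMap.ker g) s) (hs : IsSuperfluous (LinearMap.ker f)) :
    W.IsInterval (LinearMap.ker f) (W.syzygyStep s) := by
  have hf : ∀ b, f b ∈ LinearMap.ker g := fun b => (hfg _).2 ⟨b, rfl⟩
  have := h.ker (f.codRestrict _ hf) (fun y => ?_) (by rwa [LinearMap.ker_codRestrict])
  · rwa [LinearMap.ker_codRestrict] at this
  · obtain ⟨b, hb⟩ := (hfg y.1).1 y.2
    exact ⟨b, Subtype.ext hb⟩

theorem IsInterval.syzygy_succ {M : ModuleCat.{v} Aᵐᵒᵖ} (P : MinimalProjectiveResolution M)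
    {s : ZMod n × ℕ} : ∀ {i : ℕ}, W.IsInterval (P.syzygy i) s →
      W.IsInterval (P.syzygy (i + 1)) (W.syzygyStep s)
  | 0, h => by
    have := P.projective 0
    exact h.ker P.ε P.ε_surjective P.minimal_zero
  | 1, h => by
    have := P.projective 1
    exact IsInterval.ker_of_exact P.exact_zero h (P.minimal_succ 0)
  | i + 2, h => by
    have := P.projective (i + 2)
    exact IsInterval.ker_of_exact (P.exact_succ i) h (P.minimal_succ (i + 1))

theorem IsInterval.syzygy_add {M : ModuleCat.{v} Aᵐᵒᵖ} (P : MinimalProjectiveResolution M)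
    {s : ZMod n × ℕ} {i : ℕ} (h : W.IsInterval (P.syzygy i) s) (j : ℕ) :
    W.IsInterval (P.syzygy (i + j)) (W.syzygyStep^[j] s) := by
  induction j with
  | zero => exact h
  | succ j ih =>
    rw [Function.iterate_succ_apply', ← add_assoc]
    exact ih.syzygy_succ P

end PathBasis

/-- The radical of P_a is the span F of the paths of positive length: F is a maximal submodule, and
being superfluous it lies in every maximal submodule. -/
theorem Presentation.isInterval_simpleModule {k : Type u} [Field k] {A : Type v} [Ring A]
    [Algebra k A] [FiniteDimensional k A] {n : ℕ} [NeZero n] (N : Presentation k A n)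
    (a : ZMod n) : N.pathBasis.IsInterval (N.simpleModule a) (a, 1) := by
  let W := N.pathBasis
  refine ⟨W.c_pos a, (Module.jacobson Aᵐᵒᵖ (W.rightIdeal a 0)).mkQ,
    Submodule.mkQ_surjective (Module.jacobson Aᵐᵒᵖ (W.rightIdeal a 0)), fun b => ?_⟩
  refine (Submodule.Quotient.mk_eq_zero (Module.jacobson Aᵐᵒᵖ (W.rightIdeal a 0))).trans ?_
  let F : Submodule Aᵐᵒᵖ (W.rightIdeal a 0) := (W.rightIdeal a 1).comap (W.rightIdeal a 0).subtype
  suffices hF : Module.jacobson Aᵐᵒᵖ (W.rightIdeal a 0) = F by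
    rw [hF]
    rfl
  apply le_antisymm
  · refine sInf_le ⟨fun h => ?_, fun L hL => ?_⟩
    · have h1 : (⟨W.u a 0, W.u_mem_rightIdeal a 0⟩ : W.rightIdeal a 0) ∈ F := h ▸ Submodule.mem_top
      have h2 := W.mem_rightIdeal_iff.1 (show W.u a 0 ∈ W.rightIdeal a 1 from h1) a 0
        (Or.inr Nat.one_pos)
      rw [W.coord_u, if_pos ⟨rfl, rfl, W.c_pos a⟩] at h2
      exact one_ne_zero h2
    · obtain ⟨hFL, z, hzL, hzF⟩ := SetLike.lt_iff_le_and_exists.1 hL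
      have hz := W.mem_rightIdeal_iff.1 z.2
      set β := W.coord a 0 z with hβ
      have hβ0 : β ≠ 0 := by
        intro h0
        refine hzF (W.mem_rightIdeal_iff.2 fun y m hym => ?_)
        by_cases hy : y = a
        · obtain rfl : m = 0 := by
            have := hym.resolve_left (not_not_intro hy)
            omega
          rw [hy]
          exact h0
        · exact hz y m (Or.inl hy)
      have hw : (z : A) - β • W.u a 0 ∈ W.rightIdeal a 1 := by
        refine W.mem_rightIdeal_iff.2 fun y m hym => ?_
        rw [map_sub, map_smul, W.coord_u]
        by_cases hy : y = a
        · obtain rfl : m = 0 := by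
            have := hym.resolve_left (not_not_intro hy)
            omega
          subst hy
          rw [if_pos ⟨rfl, rfl, W.c_pos y⟩, smul_eq_mul, mul_one, sub_self]
        · rw [hz y m (Or.inl hy), if_neg (fun h => hy h.1.symm), smul_zero, sub_self]
      have hu : β • (⟨W.u a 0, W.u_mem_rightIdeal a 0⟩ : W.rightIdeal a 0) ∈ L := by
        have h1 := hFL (show z - β • (⟨W.u a 0, W.u_mem_rightIdeal a 0⟩ : W.rightIdeal a 0) ∈ F
          from hw)
        have := L.sub_mem hzL h1
        rwa [sub_sub_cancel] at this
      have hu' : (⟨W.u a 0, W.u_mem_rightIdeal a 0⟩ : W.rightIdeal a 0) ∈ L := by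
        have := (L.restrictScalars k).smul_mem β⁻¹ hu
        rwa [inv_smul_smul₀ hβ0] at this
      rw [Submodule.eq_top_iff']
      rintro ⟨b, hb⟩
      obtain ⟨r, rfl⟩ := Submodule.mem_span_singleton.1 hb
      exact L.smul_mem r hu'
  · refine le_sInf fun C hC => ?_
    by_contra hFC
    have h1 : F ⊔ C = ⊤ := by
      rw [sup_comm]
      exact hC.2 _ (left_lt_sup.2 hFC)
    refine hC.1 ?_
    have h2 : W.rightIdeal a 0 ≤ C.map (W.rightIdeal a 0).subtype := by
      refine W.rightIdeal_zero_le_of_sup fun b hb => ?_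
      obtain ⟨y, hy, z, hz, hyz⟩ := Submodule.mem_sup.1
        (h1 ▸ Submodule.mem_top : (⟨b, hb⟩ : W.rightIdeal a 0) ∈ F ⊔ C)
      rw [show b = (y : A) + (z : A) from congrArg Subtype.val hyz.symm]
      exact Submodule.add_mem_sup hy ⟨z, hz, rfl⟩
    rw [Submodule.eq_top_iff']
    intro b
    obtain ⟨z, hz, hzb⟩ := h2 b.2
    rwa [← Subtype.ext hzb]

/-! ### Monotone degree one maps of ℤ and the maps they induce on ℤ/n -/

section Circle

variable {n : ℕ} {g : ℤ → ℤ}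

theorem map_add_mul (hgn : ∀ y, g (y + n) = g y + n) (y t : ℤ) : g (y + t * n) = g y + t * n := by
  induction t using Int.induction_on with
  | zero => simp
  | succ t ih =>
    rw [show y + ((t : ℤ) + 1) * n = y + t * n + n by ring, hgn, ih]
    ring
  | pred t ih =>
    have := hgn (y + (-(t : ℤ) - 1) * n)
    rw [show y + (-(t : ℤ) - 1) * n + n = y + -(t : ℤ) * n by ring, ih] at this
    linarith

theorem iterate_map_add (hgn : ∀ y, g (y + n) = g y + n) (m : ℕ) (y : ℤ) :
    g^[m] (y + n) = g^[m] y + n := by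
  have : Function.Commute g (· + (n : ℤ)) := hgn
  exact this.iterate_left m y

/-- A monotone degree one self-map of `ℤ` with a fixed point fixes all points whose residue class
is periodic. -/
theorem isFixedPt_of_iterate_eq [NeZero n] (hg : Monotone g)
    (hgn : ∀ y, g (y + n) = g y + n) {c a v : ℤ}
    {m : ℕ} (hm : 0 < m) (hc : g c = c) (ha : g^[m] a = a + v * n) : g a = a := by
  have hn : (0 : ℤ) < n := by exact_mod_cast Nat.pos_of_ne_zero (NeZero.ne n)
  have hcj : ∀ (j : ℤ) (t : ℕ), g^[t] (c + j * n) = c + j * n := fun j t =>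
    Function.iterate_fixed (by rw [map_add_mul hgn, hc]) t
  -- Doubling the time handles the endpoints: trapping a between consecutive translates of c bounds
  -- v only by v ≤ 1, but bounds 2v strictly below 2.
  have h2 : g^[m + m] a = a + 2 * v * n := by
    rw [Function.iterate_add_apply, ha, map_add_mul (iterate_map_add hgn m), ha]
    ring
  set j := (a - c) / n with hj
  have hj1 : c + j * n ≤ a := by
    have := Int.ediv_mul_le (a - c) hn.ne'
    linarith
  have hj2 : a < c + (j + 1) * n := by
    have := Int.lt_ediv_add_one_mul_self (a - c) hn
    linarith
  have h3 := hg.iterate (m + m) hj1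
  have h4 := hg.iterate (m + m) hj2.le
  rw [hcj, h2] at h3 h4
  have hv : v = 0 := by
    have h5 : 2 * v < 2 := by nlinarith
    have h6 : -2 < 2 * v := by nlinarith
    omega
  rw [hv, zero_mul, add_zero] at ha
  -- The orbit of a under a monotone map is monotone, and it returns to a, so it is constant.
  rcases le_total a (g a) with h | h
  · refine le_antisymm ?_ h
    have := hg.monotone_iterate_of_le_map h (Nat.succ_le_of_lt hm)
    simpa [ha] using this
  · refine le_antisymm h ?_
    have := hg.antitone_iterate_of_map_le h (Nat.succ_le_of_lt hm)
    simpa [ha] using this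

theorem exists_eq_add_mul {x y : ℤ} (h : (x : ZMod n) = y) : ∃ t : ℤ, y = x + t * n := by
  obtain ⟨t, ht⟩ := (ZMod.intCast_eq_intCast_iff_dvd_sub _ _ _).1 h
  exact ⟨t, by linarith⟩

variable {ψ : ZMod n → ZMod n}

theorem iterate_intCast (hψ : ∀ y : ℤ, ψ y = (g y : ℤ)) (m : ℕ) (y : ℤ) :
    ψ^[m] (y : ZMod n) = (g^[m] y : ℤ) := by
  have : Function.Semiconj (fun y : ℤ => (y : ZMod n)) g ψ := fun y => (hψ y).symm
  exact ((this.iterate_right m) y).symm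

/-- With p the period of c, the lift of ψ^p can be translated by a multiple of n to fix c; it then
fixes every lift of a periodic class, so p is a period of a. -/
theorem minimalPeriod_dvd_minimalPeriod [NeZero n] (hg : Monotone g) (hgn : ∀ y, g (y + n) = g y + n)
    (hψ : ∀ y : ℤ, ψ y = (g y : ℤ)) {a c : ZMod n} (ha : a ∈ Function.periodicPts ψ) :
    Function.minimalPeriod ψ a ∣ Function.minimalPeriod ψ c := by
  obtain ⟨a, rfl⟩ := ZMod.intCast_surjective a
  obtain ⟨c, rfl⟩ := ZMod.intCast_surjective c
  set p := Function.minimalPeriod ψ (c : ZMod n) with hp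
  set m := Function.minimalPeriod ψ (a : ZMod n) with hm
  have hm0 : 0 < m := Function.minimalPeriod_pos_of_mem_periodicPts ha
  have hc : ψ^[p] (c : ZMod n) = c := Function.iterate_minimalPeriod
  rw [iterate_intCast hψ] at hc
  obtain ⟨w, hw⟩ := exists_eq_add_mul hc.symm
  let G : ℤ → ℤ := fun y => g^[p] y - w * n
  have hG : ∀ y, (G y : ZMod n) = ψ^[p] y := fun y => by
    rw [iterate_intCast hψ]
    simp [G]
  have hGn : ∀ y, G (y + n) = G y + n := fun y => by
    simp only [G, iterate_map_add hgn]
    ring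
  have hGm : Monotone G := fun x y h => sub_le_sub_right (hg.iterate p h) _
  have hGa : (ψ^[p])^[m] (a : ZMod n) = (G^[m] a : ℤ) := iterate_intCast (fun y => (hG y).symm) m a
  have hGa' : (ψ^[p])^[m] (a : ZMod n) = a := by
    rw [← Function.iterate_mul, mul_comm, Function.iterate_mul]
    exact Function.iterate_fixed Function.iterate_minimalPeriod p
  obtain ⟨v, hv⟩ := exists_eq_add_mul (hGa'.symm.trans hGa)
  have := isFixedPt_of_iterate_eq hGm hGn hm0 (show G c = c by simp only [G]; linarith) hv
  refine Function.IsPeriodicPt.minimalPeriod_dvd ?_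
  rw [Function.IsPeriodicPt, Function.IsFixedPt, ← hG, this]

theorem iterate_galoisConnection {α : Type*} [Preorder α] {f g : α → α} (h : GaloisConnection f g)
    (m : ℕ) : GaloisConnection f^[m] g^[m] := by
  induction m with
  | zero => exact GaloisConnection.id
  | succ m ih =>
    rw [Function.iterate_succ, Function.iterate_succ']
    exact h.compose ih

/-- By adjunction the fibre of g^m over the integer a is an interval. Commutation with translation
by n gives each class in the fibre of ψ^m exactly one representative in it. -/
theorem ncard_iterate_eq [NeZero n] {f : ℤ → ℤ} (hfg : GaloisConnection f g)
    (hgn : ∀ y, g (y + n) = g y + n)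
    (hψ : ∀ y : ℤ, ψ y = (g y : ℤ)) (m : ℕ) (a : ℤ) :
    {y | ψ^[m] y = (a : ZMod n)}.ncard = (f^[m] (a + 1) - f^[m] a).toNat := by
  have hn : (n : ℤ) ≠ 0 := by exact_mod_cast NeZero.ne n
  have hgc := iterate_galoisConnection hfg m
  have hmem : ∀ y : ℤ, y ∈ Set.Ico (f^[m] a) (f^[m] (a + 1)) ↔ g^[m] y = a := by
    intro y
    rw [Set.mem_Ico, hgc a y, ← not_le, hgc (a + 1) y]
    omega
  have himage : {y | ψ^[m] y = (a : ZMod n)} =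
      (fun y : ℤ => (y : ZMod n)) '' Set.Ico (f^[m] a) (f^[m] (a + 1)) := by
    ext y
    constructor
    · obtain ⟨y, rfl⟩ := ZMod.intCast_surjective y
      intro hy
      rw [Set.mem_ofPred_eq, iterate_intCast hψ] at hy
      obtain ⟨t, ht⟩ := exists_eq_add_mul hy
      refine ⟨y + t * n, ?_, by simp⟩
      rw [hmem, map_add_mul (iterate_map_add hgn m), ← ht]
    · rintro ⟨y, hy, rfl⟩
      rw [Set.mem_ofPred_eq, iterate_intCast hψ, (hmem y).1 hy]
  rw [himage, Set.InjOn.ncard_image, ← Finset.coe_Ico, Set.ncard_coe_finset, Int.card_Ico]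
  intro y hy y' hy' h
  obtain ⟨t, rfl⟩ := exists_eq_add_mul h
  rw [hmem] at hy hy'
  rw [map_add_mul (iterate_map_add hgn m), hy] at hy'
  have : t = 0 := by
    have : t * n = 0 := by linarith
    exact (mul_eq_zero.1 this).resolve_right hn
  simp [this]

end Circle

/-! ### Fibres over a periodic point of a self-map -/

section Dynamics

variable {X : Type*} {ψ : X → X} {a : X}

/-- Pigeonhole: if the same y reaches a after i steps and after j > i steps, then ψ^{j-i} fixes a.
-/
theorem mem_periodicPts_of_forall_exists [Finite X] (h : ∀ m, ∃ y, ψ^[m] y = a) :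
    a ∈ Function.periodicPts ψ := by
  choose y hy using h
  obtain ⟨i, j, hij, he⟩ := Finite.exists_ne_map_eq_of_infinite fun m => (y m)
  wlog hlt : i < j generalizing i j
  · exact this j i hij.symm he.symm (lt_of_le_of_ne (not_lt.1 hlt) hij.symm)
  refine Function.mk_mem_periodicPts (Nat.sub_pos_of_lt hlt) ?_
  have h1 := hy j
  rw [← he, ← Nat.sub_add_cancel hlt.le, Function.iterate_add_apply, hy i] at h1
  exact h1

theorem eqvGen_iterate (y : X) (m : ℕ) : Relation.EqvGen (fun x y => ψ x = y) y (ψ^[m] y) := by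
  induction m with
  | zero => exact Relation.EqvGen.refl _
  | succ m ih =>
    rw [Function.iterate_succ_apply']
    exact ih.trans _ _ _ (Relation.EqvGen.rel _ _ rfl)

theorem eqvGen_iff_exists_iterate_eq (ha : a ∈ Function.periodicPts ψ) (b : X) :
    Relation.EqvGen (fun x y => ψ x = y) a b ↔ ∃ m, ψ^[m] b = a := by
  constructor
  · intro h
    suffices H : ∀ x y, Relation.EqvGen (fun x y => ψ x = y) x y →
        ((∃ m, ψ^[m] x = a) ↔ ∃ m, ψ^[m] y = a) from (H a b h).1 ⟨0, rfl⟩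
    intro x y hxy
    induction hxy with
    | refl => rfl
    | symm _ _ _ ih => exact ih.symm
    | trans _ _ _ _ _ ih1 ih2 => exact ih1.trans ih2
    | rel x y hxy =>
      subst hxy
      constructor
      · rintro ⟨m, hm⟩
        obtain ⟨p, hp, hpa⟩ := ha
        obtain ⟨p, rfl⟩ := Nat.exists_eq_succ_of_ne_zero (Nat.pos_iff_ne_zero.1 hp)
        -- One extra turn around the cycle covers m = 0, where x is a itself and ψ x has already
        -- left it.
        refine ⟨p + m, ?_⟩
        rw [← Function.iterate_succ_apply, ← Nat.succ_add, Function.iterate_add_apply, hm]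
        exact hpa
      · rintro ⟨m, hm⟩
        exact ⟨m + 1, hm⟩
  · rintro ⟨m, rfl⟩
    exact (eqvGen_iterate b m).symm

/-- Fibres over a grow along steps of p because ψ^p fixes a; their sizes repeat with period t, so
they are constant along steps of p. Fibres at distinct levels within one period are disjoint. -/
theorem sum_ncard_iterate_eq [Finite X] {r t : ℕ} (ht : 0 < t) (ha : a ∈ Function.periodicPts ψ)
    (hN : ∀ i, {y | ψ^[r + i + t] y = a}.ncard = {y | ψ^[r + i] y = a}.ncard) :
    ∑ i ∈ Finset.range (Function.minimalPeriod ψ a), {y | ψ^[r + i] y = a}.ncard =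
      {b | Relation.EqvGen (fun x y => ψ x = y) a b}.ncard := by
  classical
  have := Fintype.ofFinite X
  set p := Function.minimalPeriod ψ a with hp
  have hp0 : 0 < p := Function.minimalPeriod_pos_of_mem_periodicPts ha
  have hpa : ∀ d, ψ^[p * d] a = a := fun d => by
    rw [Function.iterate_mul]
    exact Function.iterate_fixed Function.iterate_minimalPeriod d
  let s : ℕ → Finset X := fun i => Finset.univ.filter fun y => ψ^[r + i] y = a
  have hmem : ∀ i y, y ∈ s i ↔ ψ^[r + i] y = a := fun i y => by simp [s]
  have hs : ∀ i, {y | ψ^[r + i] y = a}.ncard = (s i).card := fun i => by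
    rw [← Set.ncard_coe_finset]
    congr 1
    ext y
    simp [s]
  have hmono : ∀ i d, s i ⊆ s (i + p * d) := by
    intro i d y hy
    rw [hmem] at hy ⊢
    rw [show r + (i + p * d) = p * d + (r + i) by ring, Function.iterate_add_apply, hy, hpa]
  have hcard : ∀ i d, (s (i + t * d)).card = (s i).card := by
    intro i d
    induction d with
    | zero => rfl
    | succ d ih =>
      rw [← ih, ← hs, ← hs, ← hN (i + t * d), show r + (i + t * (d + 1)) = r + (i + t * d) + t by ring]
  have heq : ∀ i d, s (i + p * d) ⊆ s i := by
    intro i d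
    -- The index p * t * d is a multiple of both periods, so inclusion and equal size force
    -- equality; the fibre at i + p * d is squeezed in between.
    have h1 : s i = s (i + p * (t * d)) := by
      refine Finset.eq_of_subset_of_card_le (hmono i _) ?_
      rw [show p * (t * d) = t * (p * d) by ring, hcard]
    rw [h1]
    have h2 := hmono (i + p * d) ((t - 1) * d)
    obtain ⟨t, rfl⟩ := Nat.exists_eq_succ_of_ne_zero ht.ne'
    rw [Nat.succ_sub_one] at h2
    rwa [show i + p * (t.succ * d) = i + p * d + p * (t * d) by rw [Nat.succ_eq_add_one]; ring]
  rw [Finset.sum_congr rfl fun i _ => hs i, ← Finset.card_biUnion, ← Set.ncard_coe_finset]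
  · congr 1
    ext b
    simp only [Finset.coe_biUnion, Set.mem_iUnion, Finset.mem_coe, hmem, Set.mem_ofPred_eq,
      eqvGen_iff_exists_iterate_eq ha, Finset.mem_range, exists_prop]
    constructor
    · rintro ⟨i, -, hi⟩
      exact ⟨_, hi⟩
    · rintro ⟨m, hm⟩
      -- Adding r turns of the cycle brings the level to at least r; it is then reduced modulo p.
      obtain ⟨i, hi⟩ : ∃ i, p * r + m = r + i :=
        Nat.exists_eq_add_of_le ((Nat.le_mul_of_pos_left r hp0).trans (Nat.le_add_right _ _))
      refine ⟨i % p, Nat.mod_lt _ hp0, ?_⟩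
      rw [← hmem]
      refine heq _ (i / p) ?_
      rw [Nat.mod_add_div, hmem, ← hi, Function.iterate_add_apply, hm, hpa]
  · intro i hi j hj hij
    rw [Finset.mem_coe, Finset.mem_range] at hi hj
    rw [Function.onFun, Finset.disjoint_left]
    intro y hyi hyj
    rw [hmem] at hyi hyj
    wlog hlt : i < j generalizing i j
    · exact this hj hi hij.symm hyj hyi (lt_of_le_of_ne (not_lt.1 hlt) hij.symm)
    obtain ⟨d, rfl⟩ := Nat.exists_eq_add_of_lt hlt
    rw [show r + (i + d + 1) = (d + 1) + (r + i) by ring, Function.iterate_add_apply, hyi] at hyj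
    have := Function.IsPeriodicPt.minimalPeriod_le (Nat.succ_pos d) hyj
    omega

end Dynamics

/-! ### The adjoint lifts and the double syzygy -/

namespace PathBasis

variable {k : Type u} [Field k] {A : Type v} [Ring A] [Algebra k A] {n : ℕ} [NeZero n]
  (W : PathBasis k A n)

/-- The lift to `ℤ` of the map `x ↦ x + dim P_x`. -/
def resolutionLift (x : ℤ) : ℤ := x + W.c x

/-- By the Kupisch inequality the lengths of nonzero paths ending at x form an initial segment of ℕ,
so their number is the threshold. -/
theorem lt_finrank_leftIdeal_iff (x : ZMod n) (j : ℕ) :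
    j < Module.finrank k (Submodule.span A {W.u x 0} : Submodule A A) ↔
      j < W.c (x - (j : ZMod n)) := by
  classical
  obtain ⟨C, hC⟩ : ∃ C, ∀ y, W.c y ≤ C :=
    ⟨∑ y, W.c y, fun y => Finset.single_le_sum (fun _ _ => Nat.zero_le _) (Finset.mem_univ y)⟩
  have hex : ∃ j : ℕ, ¬ j < W.c (x - (j : ZMod n)) := ⟨C, not_lt.2 (hC _)⟩
  have hdown : ∀ j d : ℕ, ¬ j < W.c (x - (j : ZMod n)) →
      ¬ j + d < W.c (x - ((j + d : ℕ) : ZMod n)) := by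
    intro j d hj
    have := W.c_le_add (x - ((j + d : ℕ) : ZMod n)) d
    rw [show x - ((j + d : ℕ) : ZMod n) + d = x - j by push_cast; ring] at this
    omega
  obtain ⟨T, hT, hmin⟩ : ∃ T : ℕ, ¬ T < W.c (x - (T : ZMod n)) ∧
      ∀ j < T, j < W.c (x - (j : ZMod n)) :=
    ⟨Nat.find hex, Nat.find_spec hex, fun j hj => not_not.1 (Nat.find_min hex hj)⟩
  have hiff : ∀ j : ℕ, j < W.c (x - (j : ZMod n)) ↔ j < T := by
    intro j
    refine ⟨fun h => ?_, hmin j⟩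
    by_contra! hj
    obtain ⟨d, rfl⟩ := Nat.exists_eq_add_of_le hj
    exact hdown _ d hT h
  have hcard : (Finset.range C).filter (fun j : ℕ => j < W.c (x - (j : ZMod n))) =
      Finset.range T := by
    ext j
    rw [Finset.mem_filter, Finset.mem_range, Finset.mem_range, hiff]
    refine ⟨fun h => h.2, fun h => ⟨?_, h⟩⟩
    exact ((hiff j).2 h).trans_le (hC _)
  rw [W.finrank_leftIdeal x C hC, hcard, Finset.card_range, hiff]

/-- The lift to `ℤ` of the map `ψ`. -/
def coresolutionLift (y : ℤ) : ℤ :=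
  y - Module.finrank k (Submodule.span A {W.u (y : ZMod n) 0} : Submodule A A)

theorem galoisConnection_lift : GaloisConnection W.resolutionLift W.coresolutionLift := by
  intro x y
  rw [resolutionLift, coresolutionLift]
  rcases lt_or_ge y x with h | h
  · omega
  · obtain ⟨d, rfl⟩ := Int.le.dest h
    have h1 := W.lt_finrank_leftIdeal_iff ((x + (d : ℤ) : ℤ) : ZMod n) d
    rw [show (((x + (d : ℤ) : ℤ) : ZMod n) - (d : ZMod n)) = (x : ZMod n) by push_cast; ring] at h1
    omega

theorem coresolutionLift_add (y : ℤ) : W.coresolutionLift (y + n) = W.coresolutionLift y + n := by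
  have : ((y + n : ℤ) : ZMod n) = y := by simp
  rw [coresolutionLift, coresolutionLift, this]
  ring

theorem iterate_syzygyStep_two_mul {x : ℤ}
    (h : ∀ j, (W.syzygyStep^[j] ((x : ZMod n), 1)).2 ≠ 0) (m : ℕ) :
    W.syzygyStep^[2 * m] ((x : ZMod n), 1) = (((W.resolutionLift^[m] x : ℤ) : ZMod n),
      (W.resolutionLift^[m] (x + 1) - W.resolutionLift^[m] x).toNat) := by
  induction m with
  | zero => simp
  | succ m ih =>
    have h0 := h (2 * m)
    have h1 := h (2 * m + 1)
    rw [show 2 * (m + 1) = 2 * m + 1 + 1 by ring, Function.iterate_succ_apply',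
      syzygyStep, if_neg h1]
    rw [Function.iterate_succ_apply', syzygyStep, if_neg h0] at h1 ⊢
    rw [ih] at h0 h1 ⊢
    simp only at h0 h1 ⊢
    rw [Function.iterate_succ_apply', Function.iterate_succ_apply']
    set y := W.resolutionLift^[m] x
    set z := W.resolutionLift^[m] (x + 1)
    obtain ⟨l, hl⟩ : ∃ l : ℕ, z = y + l := ⟨(z - y).toNat, by omega⟩
    have hl' : (z - y).toNat = l := by omega
    have hz : (z : ZMod n) = y + l := by rw [hl]; push_cast; rfl
    rw [hl'] at h0 h1 ⊢
    simp only [resolutionLift, hz] at h1 ⊢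
    refine Prod.ext ?_ ?_
    · simp only
      rw [Nat.cast_sub (by omega)]
      push_cast
      ring
    · simp only
      omega

/-- Length zero is absorbing, so one vanishing syzygy would contradict the nonzero lengths recurring
at i + t * d. -/
theorem iterate_syzygyStep_ne_zero {s : ZMod n × ℕ} {i t : ℕ} (ht : 0 < t)
    (h0 : (W.syzygyStep^[i] s).2 ≠ 0)
    (hN : ∀ j, (W.syzygyStep^[i + t + j] s).2 = (W.syzygyStep^[i + j] s).2) (j : ℕ) :
    (W.syzygyStep^[j] s).2 ≠ 0 := by
  have hzero : ∀ j d, (W.syzygyStep^[j] s).2 = 0 → (W.syzygyStep^[j + d] s).2 = 0 := by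
    intro j d hj
    induction d with
    | zero => exact hj
    | succ d ih =>
      rw [← add_assoc, Function.iterate_succ_apply', syzygyStep, if_pos ih]
      exact ih
  have hper : ∀ d, (W.syzygyStep^[i + t * d] s).2 ≠ 0 := by
    intro d
    induction d with
    | zero => exact h0
    | succ d ih =>
      rw [show i + t * (d + 1) = i + t + t * d by ring, hN]
      exact ih
  intro hj
  obtain ⟨d, hd⟩ : ∃ d, i + t * j = j + d :=
    Nat.exists_eq_add_of_le ((Nat.le_mul_of_pos_left j ht).trans (Nat.le_add_left _ _))
  exact hper j (hd ▸ hzero j d hj)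

end PathBasis

theorem Presentation.ψ_intCast {k : Type u} [Field k] {A : Type v} [Ring A] [Algebra k A]
    [FiniteDimensional k A] {n : ℕ} [NeZero n] (N : Presentation k A n) (y : ℤ) :
    N.ψ (y : ZMod n) = (N.pathBasis.coresolutionLift y : ℤ) := by
  rw [Presentation.ψ, Presentation.q, Subspace.dual_finrank_eq, PathBasis.coresolutionLift]
  push_cast
  rfl

end Nakayama

end

theorem theorem3p7 {k : Type u} [Field k] {A : Type v} [Ring A] [Algebra k A]
    [FiniteDimensional k A] {n : ℕ} [NeZero n] (N : Nakayama.Presentation k A n)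
    (a : ZMod n)
    (P : Nakayama.MinimalProjectiveResolution (N.simpleModule a))
    (r : ℕ) (hP : P.IsPeriodicAfter (2 * r))
    (p : ℕ) (hp : N.IsCoresolutionPeriodicity p) :
    ∑ i ∈ Finset.range p, Nakayama.dim k A (P.syzygy (2 * r + 2 * i)) =
      (N.coresolutionComponent a).ncard := by
  obtain ⟨x, rfl⟩ := ZMod.intCast_surjective a
  let W := N.pathBasis
  have hgc := W.galoisConnection_lift
  have hgn := W.coresolutionLift_add
  have hint : ∀ j, W.IsInterval (P.syzygy j) (W.syzygyStep^[j] ((x : ZMod n), 1)) := fun j => by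
    have h0 : W.IsInterval (P.syzygy 0) ((x : ZMod n), 1) := N.isInterval_simpleModule _
    have h1 := h0.syzygy_add P j
    rwa [zero_add] at h1
  obtain ⟨hnt, t, ht, ⟨e⟩⟩ := hP
  have h0 : (W.syzygyStep^[2 * r] ((x : ZMod n), 1)).2 ≠ 0 := by
    intro h
    have h1 := hint (2 * r)
    rw [← Prod.mk.eta (p := W.syzygyStep^[2 * r] _), h] at h1
    exact not_subsingleton _ h1.subsingleton
  have hN : ∀ j, (W.syzygyStep^[2 * r + t + j] ((x : ZMod n), 1)).2 =
      (W.syzygyStep^[2 * r + j] ((x : ZMod n), 1)).2 := fun j => by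
    -- The isomorphism gives Ω^{2r} the invariants of Ω^{2r+t} as well; taking j more syzygies and
    -- comparing dimensions equates the lengths.
    have h1 := ((hint (2 * r + t)).of_equiv e).syzygy_add P j
    rw [← (hint (2 * r + j)).dim_eq, h1.dim_eq, ← Function.iterate_add_apply, add_comm j]
  have hne := W.iterate_syzygyStep_ne_zero ht h0 hN
  have hcard : ∀ m, {y | N.ψ^[m] y = (x : ZMod n)}.ncard =
      (W.syzygyStep^[2 * m] ((x : ZMod n), 1)).2 := fun m => by
    rw [Nakayama.ncard_iterate_eq hgc hgn N.ψ_intCast, W.iterate_syzygyStep_two_mul hne]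
  have hx : (x : ZMod n) ∈ Function.periodicPts N.ψ := by
    refine Nakayama.mem_periodicPts_of_forall_exists fun m => ?_
    exact Set.nonempty_of_ncard_ne_zero (s := {y | N.ψ^[m] y = (x : ZMod n)}) (by
      rw [hcard]
      exact hne _)
  obtain ⟨c, hc, rfl⟩ := hp
  rw [Nat.dvd_antisymm (Nakayama.minimalPeriod_dvd_minimalPeriod hgc.monotone_u hgn N.ψ_intCast hc)
    (Nakayama.minimalPeriod_dvd_minimalPeriod (c := c) hgc.monotone_u hgn N.ψ_intCast hx)]
  refine Eq.trans (Finset.sum_congr rfl fun i _ => ?_)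
    (Nakayama.sum_ncard_iterate_eq (r := r) ht hx fun i => ?_)
  · rw [(hint _).dim_eq, hcard, mul_add]
  -- Raising the fibre level by t costs 2t syzygies, two periods, so the parity of t is irrelevant.
  · rw [hcard, hcard, show 2 * (r + i + t) = 2 * r + t + (2 * i + t) by ring, hN,
      show 2 * r + (2 * i + t) = 2 * r + t + 2 * i by ring, hN, mul_add]
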